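/- Let $\boldsymbol{x}=(x_1,x_2,\dots)$, $\boldsymbol\alpha=(\alpha_1,\alpha_2,\dots)$, $\boldsymbol\beta=(\beta_1,\beta_2,\dots)$ be independent formal variables, put $A_k=\alpha_1+\cdots+\alpha_k$ and $B_k=\beta_1+\cdots+\beta_k$, with $A_k=B_k=0$ for $k\le 0$. For finite sums $Y,Z$ of distinct variables let $h_m[Y]$ and $e_m[Y]$ be the complete homogeneous and the elementary symmetric polynomials of degree $m$ in the variables of $Y$, and let $$h_m[Y-Z]=\sum_{a+b=m}h_a[Y]\,(-1)^b e_b[Z].$$ Let $n\ge 0$ and let $\lambda=(\lambda_1,\dots,\lambda_n)$ be a partition with at most $n$ parts (with $\lambda_i=0$ for $i$ larger than the number of parts). The refined dual canonical stable Grothendieck polynomial is $$g_\lambda(\boldsymbol{x}_n;\boldsymbol\alpha,\boldsymbol\beta)=\frac{\det\bigl(h_{\lambda_i+n-i}[x_j-A_{\lambda_i-1}+B_{i-1}]\bigr)_{1\le i,j\le n}}{\prod_{1\le i<j\le n}(x_i-x_j)}.$$ A marked reverse plane partition of shape $\lambda$ is a filling $T$ of the cells $(i,j)$ of the Young diagram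 of $\lambda$ ($i$ the row, $j$ the column) with positive integers, weakly increasing along each row and down each column, in which every entry $T(i,j)$ such that $(i,j+1)\in\lambda$ and $T(i,j)=T(i,j+1)$ may be marked or not. Let $\mathrm{MRPP}(\lambda)$ be the set of these. The weight of $T$ is $\mathrm{wt}(T)=\prod_{(i,j)\in\lambda}\mathrm{wt}(T(i,j))$, where $\mathrm{wt}(T(i,j))$ is $-\alpha_j$ if $T(i,j)$ is marked; $\beta_{i-1}$ if $T(i,j)$ is not marked, $i\ge 2$ and $T(i,j)=T(i-1,j)$ as integers; and $x_{T(i,j)}$ otherwise. Let $\max(T)$ be the largest entry of $T$ (with $\max(T)=0$ if $\lambda=\emptyset$). Then $$g_\lambda(\boldsymbol{x}_n;\boldsymbol\alpha,\boldsymbol\beta)=\sum_{T\in\mathrm{MRPP}(\lambda),\ \max(T)\le n}\mathrm{wt}(T).$$ -/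

import Mathlib

namespace DualGrothendieck

/-- The formal variables `x₁, x₂, …`, `α₁, α₂, …`, `β₁, β₂, …`. Subscripts start at `1` as in the
usual notation; the variables with subscript `0` are never used. -/
inductive Var : Type
  | x (k : ℕ) : Var
  | α (k : ℕ) : Var
  | β (k : ℕ) : Var
deriving DecidableEq

/-- The polynomial ring over `ℤ` in all the formal variables. -/
abbrev PolyRing : Type := MvPolynomial Var ℤ

/-- The field of rational functions in all the formal variables. -/
abbrev RatField : Type := FractionRing PolyRing

/-- The variable `x_k` as a polynomial. -/
noncomputable def xvar (k : ℕ) : PolyRing := MvPolynomial.X (Var.x k)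

/-- The variable `α_k` as a polynomial. -/
noncomputable def avar (k : ℕ) : PolyRing := MvPolynomial.X (Var.α k)

/-- The variable `β_k` as a polynomial. -/
noncomputable def bvar (k : ℕ) : PolyRing := MvPolynomial.X (Var.β k)

/-- `h_m[Y]`, for a finite sum `Y` of distinct variables: the complete homogeneous symmetric
polynomial of degree `m` in these variables. -/
noncomputable def hPos (m : ℕ) (Y : Finset Var) : PolyRing :=
  MvPolynomial.rename (fun v : Y => (v : Var)) (MvPolynomial.hsymm Y ℤ m)

/-- `e_m[Z]`, for a finite sum `Z` of distinct variables: the elementary symmetric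
polynomial of degree `m` in these variables. -/
noncomputable def ePos (m : ℕ) (Z : Finset Var) : PolyRing :=
  MvPolynomial.rename (fun v : Z => (v : Var)) (MvPolynomial.esymm Z ℤ m)

/-- The plethystic substitution `h_m[Y - Z] = ∑_{a+b=m} h_a[Y] h_b[-Z]`, where
`h_b[-Z] = (-1)^b e_b[Z]`, for finite sums `Y`, `Z` of distinct variables. -/
noncomputable def hPleth (m : ℕ) (Y Z : Finset Var) : PolyRing :=
  ∑ p ∈ Finset.HasAntidiagonal.antidiagonal m, hPos p.1 Y * ((-1) ^ p.2 * ePos p.2 Z)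

/-- The variables `α₁, …, α_k` occurring in `A_k`. -/
def alphas (k : ℕ) : Finset Var := (Finset.Icc 1 k).image Var.α

/-- The variables `β₁, …, β_k` occurring in `B_k`. -/
def betas (k : ℕ) : Finset Var := (Finset.Icc 1 k).image Var.β

/-- The matrix with `(i, j)` entry `h_{λ_i+n-i}[x_j - A_{λ_i-1} + B_{i-1}]`, `1 ≤ i, j ≤ n`.
Here the row index `i` and the column index `j` start at `0`, so they stand for the usual
indices `i + 1` and `j + 1`, and `lam.rowLen i` is the part `λ_{i+1}`. The subtraction
`lam.rowLen i - 1` is truncated, in accordance with `A_{-1} = A_0 = 0`. -/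
noncomputable def gMatrix (n : ℕ) (lam : YoungDiagram) : Matrix (Fin n) (Fin n) PolyRing :=
  Matrix.of fun i j =>
    hPleth (lam.rowLen i + (n - 1 - (i : ℕ)))
      (insert (Var.x ((j : ℕ) + 1)) (betas i)) (alphas (lam.rowLen i - 1))

/-- The product `∏_{1 ≤ i < j ≤ n} (x_i - x_j)`. -/
noncomputable def vdm (n : ℕ) : PolyRing :=
  ∏ i : Fin n, ∏ j ∈ Finset.Ioi i, (xvar ((i : ℕ) + 1) - xvar ((j : ℕ) + 1))

/-- The refined dual canonical stable Grothendieck polynomial `g_λ(x_n; α, β)`, a quotient of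
two polynomials. -/
noncomputable def g (n : ℕ) (lam : YoungDiagram) : RatField :=
  algebraMap PolyRing RatField (gMatrix n lam).det / algebraMap PolyRing RatField (vdm n)

/-- A (left-)marked reverse plane partition of shape `lam`. Cells are indexed from `(0, 0)`.
The underlying reverse plane partition is `entry`, extended by `0` outside of the shape, and
`marked` is the set of marked cells. -/
@[ext]
structure MRPP (lam : YoungDiagram) where
  /-- the integer in row `i` and column `j` -/
  entry : ℕ → ℕ → ℕ
  /-- the set of marked cells -/
  marked : Finset (ℕ × ℕ)
  entry_pos : ∀ i j, (i, j) ∈ lam → 0 < entry i j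
  entry_zero : ∀ i j, (i, j) ∉ lam → entry i j = 0
  row_weak : ∀ i j₁ j₂, j₁ ≤ j₂ → (i, j₂) ∈ lam → entry i j₁ ≤ entry i j₂
  col_weak : ∀ i₁ i₂ j, i₁ ≤ i₂ → (i₂, j) ∈ lam → entry i₁ j ≤ entry i₂ j
  /-- a cell may be marked only if the cell to its right is in the shape with an equal entry -/
  marked_eq : ∀ i j, (i, j) ∈ marked →
    (i, j) ∈ lam ∧ (i, j + 1) ∈ lam ∧ entry i j = entry i (j + 1)

namespace MRPP

variable {lam : YoungDiagram}

/-- The largest entry of `T` (`0` for the empty shape). -/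
def maxEntry (T : MRPP lam) : ℕ := lam.cells.sup fun c => T.entry c.1 c.2

/-- The weight of the cell in row `i` and column `j`, both counted from `0`: in terms of
`i' = i + 1` and `j' = j + 1` it is `-α_{j'}` for a marked cell, `β_{i'-1}` for an unmarked cell
whose entry equals the entry just above it, and `x_{T(i',j')}` otherwise. -/
noncomputable def cellWt (T : MRPP lam) (i j : ℕ) : PolyRing :=
  if (i, j) ∈ T.marked then -avar (j + 1)
  else if 0 < i ∧ T.entry i j = T.entry (i - 1) j then bvar i
  else xvar (T.entry i j)

/-- The weight of a marked reverse plane partition. -/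
noncomputable def wt (T : MRPP lam) : PolyRing := ∏ c ∈ lam.cells, T.cellWt c.1 c.2

theorem finite_bounded (n : ℕ) : Finite {T : MRPP lam // T.maxEntry ≤ n} := by
  let f : {T : MRPP lam // T.maxEntry ≤ n} →
      (lam.cells → Fin (n + 1)) × lam.cells.powerset := fun T =>
    (fun c => ⟨T.1.entry c.1.1 c.1.2, Nat.lt_succ_of_le
      (le_trans (Finset.le_sup (f := fun c : ℕ × ℕ => T.1.entry c.1 c.2) c.2) T.2)⟩,
     ⟨T.1.marked, Finset.mem_powerset.2 fun c hc => (T.1.marked_eq c.1 c.2 hc).1⟩)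
  refine Finite.of_injective f ?_
  rintro ⟨S, hS⟩ ⟨T, hT⟩ h
  have h1 := congrArg Prod.fst h
  have h2 : S.marked = T.marked := congrArg (fun p => (p.2 : Finset (ℕ × ℕ))) h
  refine Subtype.ext (MRPP.ext ?_ h2)
  funext i j
  by_cases hc : (i, j) ∈ lam
  · exact congrArg Fin.val (congrFun h1 ⟨(i, j), hc⟩)
  · rw [S.entry_zero i j hc, T.entry_zero i j hc]

/-- There are finitely many marked reverse plane partitions of a given shape with
entries at most `n`. -/
noncomputable instance fintypeBounded (n : ℕ) : Fintype {T : MRPP lam // T.maxEntry ≤ n} :=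
  @Fintype.ofFinite _ (finite_bounded n)

end MRPP

end DualGrothendieck

/-! Both sides obey the same branching rule in the number of variables. In a marked reverse plane
partition with entries at most `n + 1`, the cells with entries at most `n` form a diagram `mu ≤
lam`. In each column of `lam / mu` the top cell contributes `x_{n+1}` and a lower cell in row `i`
(counted from 0) contributes `β_i`; marking adds the alternative `-α` exactly when the cell has a
right neighbour in `lam`. Summing over markings gives the product of the `colWt`
(`MRPP.sum_wt_succ`).

On the algebraic side, the bialternant is a Jacobi–Trudi determinant times the Vandermonde product
(`det_gMatrix`): multiplying the rows of coefficients by the matrix of coefficients of `∏_{l ≠ j} (1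
- x_l T)` cancels all variables except `x_j`. The Jacobi–Trudi determinant satisfies the same
branching rule (`jtDet_succ`). To see this, the columns of `lam` are peeled off from right to left.
Each row is a combination of shorter rows in two ways, one removing `x_{n+1}` and one removing a
`β`; repeated rows kill most terms of the multilinear expansion (`rowDet_expand`), and what survives
is one term per length `s` of the column of `mu`.

The size `L` of the determinant is kept independent of `n`, so the induction on `n` in
`sum_wt_eq_jtDet` can fix `L`. -/

namespace DualGrothendieck

open Finset

/-! ### Multilinear expansion of determinants with repeated rows -/

section RowDet

variable {R : Type*} [CommRing R]

/-- The determinant of the matrix with rows `v 0, …, v (L - 1)`. -/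
def rowDet (L : ℕ) (v : ℕ → Fin L → R) : R := (Matrix.of fun i : Fin L => v i).det

theorem rowDet_congr {L : ℕ} {v w : ℕ → Fin L → R} (h : ∀ i < L, v i = w i) :
    rowDet L v = rowDet L w := by
  unfold rowDet
  congr 1
  ext i j
  exact congrFun (h i i.2) j

theorem rowDet_eq_zero {L : ℕ} {v : ℕ → Fin L → R} {a b : ℕ} (ha : a < L) (hb : b < L)
    (hab : a ≠ b) (h : v a = v b) : rowDet L v = 0 :=
  Matrix.det_zero_of_row_eq (M := Matrix.of fun i : Fin L => v i) (i := ⟨a, ha⟩) (j := ⟨b, hb⟩)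
    (by simpa [Fin.ext_iff] using hab) h

theorem rowDet_eq_zero_of_row {L : ℕ} {v : ℕ → Fin L → R} {a : ℕ} (ha : a < L) (h : v a = 0) :
    rowDet L v = 0 :=
  Matrix.det_eq_zero_of_row_eq_zero (A := Matrix.of fun i : Fin L => v i) ⟨a, ha⟩
    fun j => congrFun h j

theorem rowDet_add {L : ℕ} {v : ℕ → Fin L → R} {a : ℕ} (ha : a < L) {u w : Fin L → R} {p : R}
    (h : v a = u + p • w) :
    rowDet L v = rowDet L (Function.update v a u) + p * rowDet L (Function.update v a w) := by
  have key : ∀ u : Fin L → R, rowDet L (Function.update v a u) =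
      (Matrix.updateRow (Matrix.of fun i : Fin L => v i) ⟨a, ha⟩ u).det := by
    intro u
    unfold rowDet
    congr 1
    ext i j
    by_cases hi : (i : ℕ) = a
    · have : i = ⟨a, ha⟩ := Fin.ext hi
      subst this
      simp
    · have : i ≠ ⟨a, ha⟩ := fun h => hi (congrArg Fin.val h)
      simp [Matrix.updateRow_ne this, Function.update_of_ne hi]
  rw [key, key, ← Matrix.det_updateRow_smul, ← Matrix.det_updateRow_add, ← h, ← key,
    Function.update_eq_self]

/-- Row `b` splits as `Y (b - 1) + q b • Y b`, and `Y (b - 1)` already stands in row `b - 1`. Only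
the second summand survives, and then row `b + 1` is in the same situation. -/
theorem rowDet_cascade {L : ℕ} (V W X Y : ℕ → Fin L → R) (q : ℕ → R) (a c : ℕ) (hc : c ≤ L)
    (hXY : ∀ i, a ≤ i → i + 1 < c → X (i + 1) = Y i + q (i + 1) • Y (i + 1)) (d b : ℕ)
    (hab : a < b) (hb : b + d = c) :
    rowDet L (fun i => if i < a then V i else if i < b then Y i else if i < c then X i else W i) =
      (∏ i ∈ Ico b c, q i) *
        rowDet L (fun i => if i < a then V i else if i < c then Y i else W i) := by
  induction d generalizing b with
  | zero =>
    obtain rfl : b = c := by omega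
    simp only [Ico_self, prod_empty, one_mul]
    refine rowDet_congr fun i _ => ?_
    grind
  | succ d ih =>
    have hbc : b < c := by omega
    obtain ⟨k, rfl⟩ : ∃ k, b = k + 1 := ⟨b - 1, by omega⟩
    rw [rowDet_add (a := k + 1) (u := Y k) (w := Y (k + 1)) (p := q (k + 1)) (by omega)
      (by rw [if_neg (by omega), if_neg (by omega), if_pos hbc]; exact hXY k (by omega) hbc),
      rowDet_eq_zero (a := k + 1) (b := k) (by omega) (by omega) (by omega)
        (by rw [Function.update_self, Function.update_of_ne (by omega)]; grind),
      zero_add, prod_eq_prod_Ico_succ_bot hbc, mul_assoc, ← ih (k + 2) (by omega) (by omega)]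
    congr 1
    refine rowDet_congr fun i _ => ?_
    by_cases hi : i = k + 1
    · subst hi
      rw [Function.update_self]; grind
    · rw [Function.update_of_ne hi]; grind

/-- Simultaneous expansion of the rows `X i`, `a ≤ i < c`, of a determinant. -/
theorem rowDet_expand {L : ℕ} (W X Y Z : ℕ → Fin L → R) (p q : ℕ → R) (c : ℕ) (hc : c ≤ L)
    (d a : ℕ) (had : a + d = c) (V : ℕ → Fin L → R)
    (hXZ : ∀ i, a ≤ i → i < c → X i = Z i + p i • Y i)
    (hXY : ∀ i, a ≤ i → i + 1 < c → X (i + 1) = Y i + q (i + 1) • Y (i + 1)) :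
    rowDet L (fun i => if i < a then V i else if i < c then X i else W i) =
      ∑ s ∈ Icc a c, (∏ i ∈ Ico s c, if i = s then p i else q i) *
        rowDet L (fun i => if i < a then V i else if i < s then Z i else
          if i < c then Y i else W i) := by
  induction d generalizing a V with
  | zero =>
    obtain rfl : a = c := by omega
    simp only [Icc_self, sum_singleton, Ico_self, prod_empty, one_mul]
    refine rowDet_congr fun i _ => ?_
    grind
  | succ d ih =>
    have hac : a < c := by omega
    rw [rowDet_add (a := a) (by omega) (u := Z a) (w := Y a) (p := p a)
      (by rw [if_neg (by omega), if_pos hac]; exact hXZ a le_rfl hac),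
      ← Finset.insert_Icc_add_one_left_eq_Icc hac.le, sum_insert (by simp), add_comm]
    congr 1
    -- Choosing `Y a` in row `a` forces all later choices: this is the summand `s = a`.
    · have h1 := rowDet_cascade V W X Y q a c hc hXY d (a + 1) (by omega) (by omega)
      have h2 : ∏ i ∈ Ico a c, (if i = a then p i else q i) = p a * ∏ i ∈ Ico (a + 1) c, q i := by
        rw [prod_eq_prod_Ico_succ_bot hac, if_pos rfl]
        congr 1
        refine prod_congr rfl fun i hi => if_neg ?_
        have := (mem_Ico.1 hi).1
        omega
      rw [h2, mul_assoc]
      congr 1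
      refine Eq.trans ?_ (h1.trans ?_)
      · refine rowDet_congr fun i _ => ?_
        by_cases hi : i = a
        · subst hi
          rw [Function.update_self]; grind
        · rw [Function.update_of_ne hi]; grind
      · congr 1
        refine rowDet_congr fun i _ => ?_
        grind
    -- Choosing `Z a` leaves row `a + 1` free; the chosen row is absorbed into `V`.
    · have h1 := ih (a + 1) (by omega) (fun i => if i < a then V i else Z i)
        (fun i h => hXZ i (by omega)) (fun i h => hXY i (by omega))
      refine Eq.trans ?_ (h1.trans ?_)
      · refine rowDet_congr fun i _ => ?_
        by_cases hi : i = a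
        · subst hi
          rw [Function.update_self]; grind
        · rw [Function.update_of_ne hi]; grind
      · refine sum_congr rfl fun s hs => ?_
        rw [mem_Icc] at hs
        congr 1
        refine rowDet_congr fun i _ => ?_
        grind

end RowDet

/-! ### Generating series and their recurrences -/

section Series

open PowerSeries

variable {R : Type*} [CommRing R]

/-- The geometric series `1 / (1 - a T)`. -/
noncomputable def geom (a : R) : R⟦X⟧ := PowerSeries.mk fun k => a ^ k

theorem one_sub_mul_geom (a : R) : (1 - C a * X) * geom a = 1 := by
  ext k
  rw [sub_mul, one_mul, map_sub, mul_assoc, coeff_C_mul]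
  cases k with
  | zero => simp [geom]
  | succ k => simp [geom, coeff_succ_X_mul, pow_succ', coeff_one]

theorem geom_eq (a : R) : geom a = 1 + C a * X * geom a := by
  linear_combination one_sub_mul_geom a

theorem coeff_prod_one_sub_eq_zero {ι R : Type*} [CommRing R] (s : Finset ι) (a : ι → R)
    {m : ℕ} (h : #s < m) : coeff m (∏ i ∈ s, (1 - C (a i) * X)) = 0 := by
  classical
  induction s using Finset.induction_on generalizing m with
  | empty =>
    rw [prod_empty, coeff_one, if_neg]
    rw [card_empty] at h
    omega
  | insert i s hi ih =>
    rw [card_insert_of_notMem hi] at h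
    obtain ⟨m, rfl⟩ : ∃ l, m = l + 1 := ⟨m - 1, by omega⟩
    rw [prod_insert hi, sub_mul, one_mul, map_sub, ih (by omega), mul_assoc, coeff_C_mul,
      coeff_succ_X_mul, ih (by omega), mul_zero, sub_zero]

end Series

open PowerSeries

/-- The generating series of `h_m[x_1 + ⋯ + x_n - A_k + B_b]`. -/
noncomputable def hSeries (n k b : ℕ) : PolyRing⟦X⟧ :=
  (∏ i ∈ range n, geom (xvar (i + 1))) * (∏ i ∈ range b, geom (bvar (i + 1))) *
    ∏ i ∈ range k, (1 - C (avar (i + 1)) * X)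

theorem hSeries_succ_x (n k b : ℕ) :
    hSeries (n + 1) k b = hSeries n k b + C (xvar (n + 1)) * X * hSeries (n + 1) k b := by
  simp only [hSeries, prod_range_succ]
  linear_combination ((∏ i ∈ range n, geom (xvar (i + 1))) * (∏ i ∈ range b, geom (bvar (i + 1))) *
    ∏ i ∈ range k, (1 - C (avar (i + 1)) * X)) * geom_eq (xvar (n + 1))

theorem hSeries_succ_b (n k b : ℕ) :
    hSeries n k (b + 1) = hSeries n k b + C (bvar (b + 1)) * X * hSeries n k (b + 1) := by
  simp only [hSeries, prod_range_succ]
  linear_combination ((∏ i ∈ range n, geom (xvar (i + 1))) * (∏ i ∈ range b, geom (bvar (i + 1))) *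
    ∏ i ∈ range k, (1 - C (avar (i + 1)) * X)) * geom_eq (bvar (b + 1))

theorem hSeries_succ_a (n k b : ℕ) :
    hSeries n (k + 1) b = hSeries n k b - C (avar (k + 1)) * X * hSeries n k b := by
  simp only [hSeries, prod_range_succ]
  ring

theorem coeff_succ_pow_mul {m i : ℕ} (P Q S : PolyRing⟦X⟧) (c : PolyRing)
    (h : P = Q + C c * X * S) :
    coeff (m + 1) (X ^ i * P) = coeff (m + 1) (X ^ i * Q) + c * coeff m (X ^ i * S) := by
  have : X ^ i * P = X ^ i * Q + C c * (X * (X ^ i * S)) := by rw [h]; ring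
  rw [this, map_add, coeff_C_mul, coeff_succ_X_mul]

/-! ### Recurrences between Jacobi–Trudi rows -/

/-- The row `(h_{m - i + j}[x_1 + ⋯ + x_n - A_{m - 1} + B_i])_j`. -/
noncomputable def jtRow (L n i m : ℕ) : Fin L → PolyRing :=
  fun j => coeff (m + j) (X ^ i * hSeries n (m - 1) i)

/-- The row `(h_{m - i + j}[x_1 + ⋯ + x_n - A_m + B_i])_j`. -/
noncomputable def jtRow' (L n i m : ℕ) : Fin L → PolyRing :=
  fun j => coeff (m + j) (X ^ i * hSeries n m i)

/-- Together with `jtRow_succ_eq`, this removes a cell by means of `x_{n+1}`. The term `-α_{t+1}`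
appears when the row continues beyond that cell, and is absent when the cell ends the row. -/
theorem jtRow'_succ_eq (L n i t : ℕ) : jtRow' L (n + 1) i (t + 1) =
    jtRow L n i (t + 1) + (xvar (n + 1) - avar (t + 1)) • jtRow' L (n + 1) i t := by
  funext j
  simp only [jtRow', jtRow, Pi.add_apply, Pi.smul_apply, smul_eq_mul, add_tsub_cancel_right,
    add_right_comm t 1 (j : ℕ)]
  refine coeff_succ_pow_mul _ _ _ _ ?_
  rw [hSeries_succ_a, map_sub]
  linear_combination hSeries_succ_x n t i

theorem jtRow_succ_eq (L n i t : ℕ) : jtRow L (n + 1) i (t + 1) =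
    jtRow L n i (t + 1) + xvar (n + 1) • jtRow' L (n + 1) i t := by
  funext j
  simp only [jtRow', jtRow, Pi.add_apply, Pi.smul_apply, smul_eq_mul, add_tsub_cancel_right,
    add_right_comm t 1 (j : ℕ)]
  exact coeff_succ_pow_mul _ _ _ _ (hSeries_succ_x n t i)

theorem coeff_succ_pow_succ_mul {m i : ℕ} (P Q S : PolyRing⟦X⟧) (c : PolyRing)
    (h : P = Q + C c * X * S) :
    coeff (m + 1) (X ^ (i + 1) * P) = coeff m (X ^ i * Q) + c * coeff m (X ^ (i + 1) * S) := by
  rw [coeff_succ_pow_mul P Q S c h, pow_succ' X i, mul_assoc X, coeff_succ_X_mul]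

/-- Here `β_{i+1}` is removed instead of `x_{n+1}`. Passing to row `i` lowers the power of `X` by
one, which matches the loss of one cell. -/
theorem jtRow'_succ_succ (L n i t : ℕ) : jtRow' L n (i + 1) (t + 1) =
    jtRow' L n i t + (bvar (i + 1) - avar (t + 1)) • jtRow' L n (i + 1) t := by
  funext j
  simp only [jtRow', Pi.add_apply, Pi.smul_apply, smul_eq_mul, add_right_comm t 1 (j : ℕ)]
  refine coeff_succ_pow_succ_mul _ _ _ _ ?_
  rw [hSeries_succ_a, map_sub]
  linear_combination hSeries_succ_b n t i

theorem jtRow_succ_succ (L n i t : ℕ) : jtRow L n (i + 1) (t + 1) =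
    jtRow' L n i t + bvar (i + 1) • jtRow' L n (i + 1) t := by
  funext j
  simp only [jtRow', jtRow, Pi.add_apply, Pi.smul_apply, smul_eq_mul, add_tsub_cancel_right,
    add_right_comm t 1 (j : ℕ)]
  exact coeff_succ_pow_succ_mul _ _ _ _ (hSeries_succ_b n t i)

/-- The row `(h_{-1 - i + j}[x_1 + ⋯ + x_n + B_i])_j`. -/
noncomputable def jtRowNeg (L n i : ℕ) : Fin L → PolyRing :=
  fun j => coeff j (X ^ (i + 1) * hSeries n 0 i)

theorem jtRow_zero_eq (L n i : ℕ) : jtRow L (n + 1) i 0 =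
    jtRow L n i 0 + xvar (n + 1) • jtRowNeg L (n + 1) i := by
  funext j
  have : X ^ i * hSeries (n + 1) 0 i =
      X ^ i * hSeries n 0 i + C (xvar (n + 1)) * (X ^ (i + 1) * hSeries (n + 1) 0 i) := by
    linear_combination X ^ i * hSeries_succ_x n 0 i
  simp [jtRow, jtRowNeg, this]

theorem jtRow_succ_zero (L n i : ℕ) : jtRow L n (i + 1) 0 =
    jtRowNeg L n i + bvar (i + 1) • jtRowNeg L n (i + 1) := by
  funext j
  have : X ^ (i + 1) * hSeries n 0 (i + 1) =
      X ^ (i + 1) * hSeries n 0 i + C (bvar (i + 1)) * (X ^ (i + 2) * hSeries n 0 (i + 1)) := by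
    linear_combination X ^ (i + 1) * hSeries_succ_b n 0 i
  simp [jtRow, jtRowNeg, this]

/-- All subscripts `j - (L + 1)` of the `h`'s are negative. -/
theorem jtRowNeg_last (L n : ℕ) : jtRowNeg (L + 1) n L = 0 := by
  funext j
  rw [jtRowNeg, coeff_X_pow_mul', if_neg (by omega), Pi.zero_apply]

/-- The Jacobi–Trudi determinant `det (h_{λ_i - i + j}[x_1 + ⋯ + x_n - A_{λ_i - 1} + B_{i - 1}])`
of size `L`. -/
noncomputable def jtDet (L n : ℕ) (lam : YoungDiagram) : PolyRing :=
  rowDet L fun i => jtRow L n i (lam.rowLen i)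

/-! ### Young diagrams through their columns -/

section Diagrams

theorem colLen_eq_of_mem_iff {mu : YoungDiagram} {j k : ℕ} (h : ∀ i, (i, j) ∈ mu ↔ i < k) :
    mu.colLen j = k :=
  eq_of_forall_lt_iff fun i => by rw [← YoungDiagram.mem_iff_lt_colLen, h]

theorem rowLen_eq_of_mem_iff {mu : YoungDiagram} {i k : ℕ} (h : ∀ j, (i, j) ∈ mu ↔ j < k) :
    mu.rowLen i = k :=
  eq_of_forall_lt_iff fun j => by rw [← YoungDiagram.mem_iff_lt_rowLen, h]

theorem lt_rowLen_iff_lt_colLen {mu : YoungDiagram} {i j : ℕ} :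
    j < mu.rowLen i ↔ i < mu.colLen j := by
  rw [← YoungDiagram.mem_iff_lt_rowLen, YoungDiagram.mem_iff_lt_colLen]

theorem eq_of_colLen_eq {mu nu : YoungDiagram} (h : ∀ j, mu.colLen j = nu.colLen j) :
    mu = nu := by
  ext ⟨i, j⟩
  rw [YoungDiagram.mem_cells, YoungDiagram.mem_cells, YoungDiagram.mem_iff_lt_colLen,
    YoungDiagram.mem_iff_lt_colLen, h]

theorem colLen_mono {mu lam : YoungDiagram} (h : mu ≤ lam) (j : ℕ) :
    mu.colLen j ≤ lam.colLen j := by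
  refine le_of_forall_lt fun i hi => ?_
  rw [← YoungDiagram.mem_iff_lt_colLen] at hi ⊢
  exact h hi

/-- The finite set of the Young diagrams contained in `lam`. -/
noncomputable def subDiagrams (lam : YoungDiagram) : Finset YoungDiagram :=
  (((lam.cells.powerset.finite_toSet).preimage (f := YoungDiagram.cells)
    fun _ _ _ _ h => YoungDiagram.ext h)).toFinset

theorem mem_subDiagrams {lam mu : YoungDiagram} : mu ∈ subDiagrams lam ↔ mu ≤ lam := by
  simp [subDiagrams, YoungDiagram.cells_subset_iff]

/-- Replacing the columns `0, …, t` of `rho` by columns of length `s`. -/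
theorem exists_replace_cols {lam rho : YoungDiagram} (h : rho ≤ lam) {t s : ℕ}
    (h1 : rho.colLen (t + 1) ≤ s) (h2 : s ≤ lam.colLen t) :
    ∃ sigma ≤ lam, ∀ i j, (i, j) ∈ sigma ↔ if j ≤ t then i < s else (i, j) ∈ rho := by
  have key : ∀ i j, (if j ≤ t then i < s else (i, j) ∈ rho) → (i, j) ∈ lam := by
    intro i j hij
    split_ifs at hij with hj
    · exact YoungDiagram.up_left_mem lam le_rfl hj
        (YoungDiagram.mem_iff_lt_colLen.2 (hij.trans_le h2))
    · exact h hij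
  refine ⟨⟨lam.cells.filter fun c => if c.2 ≤ t then c.1 < s else c ∈ rho, ?_⟩, ?_, ?_⟩
  · rintro ⟨i, j⟩ ⟨i', j'⟩ ⟨hi, hj⟩ hc
    simp only [Finset.coe_filter, Set.mem_ofPred_eq, YoungDiagram.mem_cells] at hc ⊢
    simp only at hi hj
    refine ⟨YoungDiagram.up_left_mem lam hi hj hc.1, ?_⟩
    have hc2 := hc.2
    by_cases h3 : j ≤ t
    · rw [if_pos h3] at hc2
      rw [if_pos (hj.trans h3)]
      exact hi.trans_lt hc2
    · rw [if_neg h3] at hc2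
      split_ifs with h4
      · refine hi.trans_lt (lt_of_lt_of_le ?_ h1)
        rw [← YoungDiagram.mem_iff_lt_colLen]
        exact YoungDiagram.up_left_mem rho le_rfl (by omega) hc2
      · exact YoungDiagram.up_left_mem rho hi hj hc2
  · intro c hc
    exact (Finset.mem_filter.1 hc).1
  · intro i j
    rw [← YoungDiagram.mem_cells]
    simp only [Finset.mem_filter, YoungDiagram.mem_cells]
    exact ⟨fun hc => hc.2, fun hc => ⟨key i j hc, hc⟩⟩

end Diagrams

/-! ### Branching rule for the Jacobi–Trudi determinant -/

/-- The weight of the part of column `t` of `lam` below its first `s` cells, all of whose entries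
are `n + 1`. -/
noncomputable def colWt (n : ℕ) (lam : YoungDiagram) (t s : ℕ) : PolyRing :=
  ∏ i ∈ Ico s (lam.colLen t), ((if i = s then xvar (n + 1) else bvar i) -
    if t + 1 < lam.rowLen i then avar (t + 1) else 0)

/-- Row `i` of the Jacobi–Trudi matrix of `lam` when `λ_i ≤ t`, and its analogue for the first `t`
cells of the row when `t < λ_i`. -/
noncomputable def truncRow (L n : ℕ) (lam : YoungDiagram) (t i : ℕ) : Fin L → PolyRing :=
  -- A proper initial segment of a row carries `A_t`, a complete row of length `t` only `A_{t-1}`: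
  -- the last cell of a row cannot be marked.
  if t < lam.rowLen i then jtRow' L n i t else jtRow L n i (lam.rowLen i)

theorem truncRow_succ_eq (L n : ℕ) (lam : YoungDiagram) (t i : ℕ) (h : i < lam.colLen t) :
    truncRow L (n + 1) lam (t + 1) i = jtRow L n i (t + 1) +
      (xvar (n + 1) - if t + 1 < lam.rowLen i then avar (t + 1) else 0) •
        truncRow L (n + 1) lam t i := by
  have h' := lt_rowLen_iff_lt_colLen.2 h
  unfold truncRow
  rw [if_pos h']
  split_ifs with h1
  · exact jtRow'_succ_eq L n i t
  · rw [show lam.rowLen i = t + 1 by omega, sub_zero]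
    exact jtRow_succ_eq L n i t

theorem truncRow_succ_succ (L n : ℕ) (lam : YoungDiagram) (t i : ℕ) (h : i + 1 < lam.colLen t) :
    truncRow L n lam (t + 1) (i + 1) = truncRow L n lam t i +
      (bvar (i + 1) - if t + 1 < lam.rowLen (i + 1) then avar (t + 1) else 0) •
        truncRow L n lam t (i + 1) := by
  have h' := lt_rowLen_iff_lt_colLen.2 h
  have h'' := lam.rowLen_anti i (i + 1) (by omega)
  unfold truncRow
  rw [if_pos h', if_pos (h'.trans_le h'')]
  split_ifs with h1
  · exact jtRow'_succ_succ L n i t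
  · rw [show lam.rowLen (i + 1) = t + 1 by omega, sub_zero]
    exact jtRow_succ_succ L n i t

/-- The determinant that interpolates between `jtDet L (n + 1) lam` (for `t` large and `rho` empty)
and `jtDet L n rho` (for `t = 0`). -/
noncomputable def mixedDet (L n : ℕ) (lam : YoungDiagram) (t : ℕ) (rho : YoungDiagram) :
    PolyRing :=
  rowDet L fun i =>
    if i < rho.colLen t then jtRow L n i (rho.rowLen i) else truncRow L (n + 1) lam t i

/-- The rows outside `rho` are empty but still involve `x_{n+1}`. Expanding them as for a column,
every term that uses a `jtRowNeg` has one in its last row, which vanishes; only `s = L` remains. -/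
theorem mixedDet_zero (L n : ℕ) {lam rho : YoungDiagram} (hL : lam.colLen 0 ≤ L)
    (hrho : rho ≤ lam) : mixedDet L n lam 0 rho = jtDet L n rho := by
  have ha : rho.colLen 0 ≤ L := (colLen_mono hrho 0).trans hL
  have h1 := rowDet_expand (L := L) (fun _ => 0) (fun i => jtRow L (n + 1) i 0)
    (fun i => jtRowNeg L (n + 1) i) (fun i => jtRow L n i 0) (fun _ => xvar (n + 1)) bvar L le_rfl
    (L - rho.colLen 0) (rho.colLen 0) (by omega) (fun i => jtRow L n i (rho.rowLen i))
    (fun i _ _ => jtRow_zero_eq L n i) (fun i _ _ => jtRow_succ_zero L (n + 1) i)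
  rw [sum_eq_single L] at h1
  · rw [Ico_self, prod_empty, one_mul] at h1
    refine Eq.trans ?_ (h1.trans ?_)
    · refine rowDet_congr fun i hi => ?_
      simp only [hi, if_true, truncRow]
      split_ifs with h2 h3
      · rfl
      · rfl
      · rw [show lam.rowLen i = 0 by omega]
    · refine rowDet_congr fun i hi => ?_
      simp only [hi, if_true]
      split_ifs with h2
      · rfl
      · have : ¬ 0 < rho.rowLen i := by rwa [lt_rowLen_iff_lt_colLen]
        rw [show rho.rowLen i = 0 by omega]
  · intro s hs hsL
    rw [mem_Icc] at hs
    obtain ⟨k, rfl⟩ : ∃ k, L = k + 1 := ⟨L - 1, by omega⟩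
    rw [rowDet_eq_zero_of_row (a := k) (by omega), mul_zero]
    rw [if_neg (by omega), if_neg (by omega), if_pos (by omega)]
    exact jtRowNeg_last k (n + 1)
  · intro h
    exact absurd (mem_Icc.2 ⟨ha, le_rfl⟩) h

/-- `rowDet_expand` applied to the rows meeting column `t` but not yet fixed by `rho`; `s` becomes
the length of column `t` of the inner shape. -/
theorem mixedDet_succ (L n : ℕ) {lam rho : YoungDiagram} (t : ℕ) (hL : lam.colLen 0 ≤ L)
    (hrho : rho ≤ lam) :
    mixedDet L n lam (t + 1) rho = ∑ s ∈ Icc (rho.colLen (t + 1)) (lam.colLen t),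
      colWt n lam t s * rowDet L fun i =>
        if i < rho.colLen (t + 1) then jtRow L n i (rho.rowLen i) else
        if i < s then jtRow L n i (t + 1) else truncRow L (n + 1) lam t i := by
  have hc : lam.colLen t ≤ L := (lam.colLen_anti 0 t (Nat.zero_le t)).trans hL
  have ha : rho.colLen (t + 1) ≤ lam.colLen t :=
    (colLen_mono hrho _).trans (lam.colLen_anti t (t + 1) (Nat.le_succ t))
  have h1 := rowDet_expand (L := L) (fun i => jtRow L (n + 1) i (lam.rowLen i))
    (truncRow L (n + 1) lam (t + 1)) (truncRow L (n + 1) lam t) (fun i => jtRow L n i (t + 1))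
    (fun i => xvar (n + 1) - if t + 1 < lam.rowLen i then avar (t + 1) else 0)
    (fun i => bvar i - if t + 1 < lam.rowLen i then avar (t + 1) else 0) (lam.colLen t) hc
    (lam.colLen t - rho.colLen (t + 1)) (rho.colLen (t + 1)) (by omega)
    (fun i => jtRow L n i (rho.rowLen i))
    (fun i _ h => truncRow_succ_eq L n lam t i h)
    (fun i _ h => truncRow_succ_succ L (n + 1) lam t i h)
  have h2 : ∀ i t', t ≤ t' → ¬ i < lam.colLen t →
      truncRow L (n + 1) lam t' i = jtRow L (n + 1) i (lam.rowLen i) := by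
    intro i t' ht hi
    rw [← lt_rowLen_iff_lt_colLen] at hi
    exact if_neg (by omega)
  refine Eq.trans ?_ (h1.trans ?_)
  · refine rowDet_congr fun i _ => ?_
    split_ifs with h3 h4
    · rfl
    · rfl
    · exact h2 i _ (Nat.le_succ t) h4
  · refine sum_congr rfl fun s _ => ?_
    congr 1
    · refine prod_congr rfl fun i _ => ?_
      split_ifs <;> rfl
    · refine rowDet_congr fun i _ => ?_
      split_ifs with h3 h4 h5
      · rfl
      · rfl
      · rfl
      · exact (h2 i _ le_rfl h5).symm

open Classical in
theorem mixedDet_eq_sum (L n : ℕ) {lam : YoungDiagram} (hL : lam.colLen 0 ≤ L) (t : ℕ)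
    (rho : YoungDiagram) (hrho : rho ≤ lam) :
    mixedDet L n lam t rho =
      ∑ mu ∈ subDiagrams lam with ∀ j, t ≤ j → mu.colLen j = rho.colLen j,
        (∏ j ∈ range t, colWt n lam j (mu.colLen j)) * jtDet L n mu := by
  induction t generalizing rho with
  | zero =>
    have : ({mu ∈ subDiagrams lam | ∀ j, 0 ≤ j → mu.colLen j = rho.colLen j}) = {rho} := by
      ext mu
      simp only [mem_filter, mem_subDiagrams, mem_singleton]
      exact ⟨fun h => eq_of_colLen_eq fun j => h.2 j (Nat.zero_le j),
        by rintro rfl; exact ⟨hrho, fun _ _ => rfl⟩⟩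
    rw [this, sum_singleton, range_zero, prod_empty, one_mul, mixedDet_zero L n hL hrho]
  | succ t ih =>
    rw [mixedDet_succ L n t hL hrho, ← sum_fiberwise_of_maps_to (g := fun mu : YoungDiagram => mu.colLen t)
      (t := Icc (rho.colLen (t + 1)) (lam.colLen t))]
    · refine sum_congr rfl fun s hs => ?_
      rw [mem_Icc] at hs
      -- Only the columns of `sigma` from `t` on matter; length `s` in the earlier ones makes it a
      -- diagram.
      obtain ⟨sigma, hsig, hmem⟩ := exists_replace_cols hrho hs.1 hs.2
      have hcol : ∀ j, sigma.colLen j = if j ≤ t then s else rho.colLen j := by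
        intro j
        refine colLen_eq_of_mem_iff fun i => ?_
        rw [hmem]
        split_ifs
        · rfl
        · exact YoungDiagram.mem_iff_lt_colLen
      have hdet : mixedDet L n lam t sigma = rowDet L fun i =>
          if i < rho.colLen (t + 1) then jtRow L n i (rho.rowLen i) else
          if i < s then jtRow L n i (t + 1) else truncRow L (n + 1) lam t i := by
        refine rowDet_congr fun i _ => ?_
        rw [hcol t, if_pos le_rfl]
        by_cases h1 : i < rho.colLen (t + 1)
        · rw [if_pos (h1.trans_le hs.1), if_pos h1]
          congr 1
          refine rowLen_eq_of_mem_iff fun j => ?_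
          rw [hmem, ← YoungDiagram.mem_iff_lt_rowLen]
          split_ifs with hj
          · refine ⟨fun _ => ?_, fun _ => h1.trans_le hs.1⟩
            exact YoungDiagram.up_left_mem rho le_rfl (by omega)
              (YoungDiagram.mem_iff_lt_colLen.2 h1)
          · rfl
        · rw [if_neg h1]
          split_ifs with h2
          · congr 1
            refine rowLen_eq_of_mem_iff fun j => ?_
            rw [hmem]
            split_ifs with hj
            · exact ⟨fun _ => by omega, fun _ => h2⟩
            · refine ⟨fun h => absurd ?_ h1, fun h => by omega⟩
              rw [← YoungDiagram.mem_iff_lt_colLen]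
              exact YoungDiagram.up_left_mem rho le_rfl (by omega) h
          · rfl
      rw [← hdet, ih sigma hsig, mul_sum]
      refine sum_congr ?_ fun mu hmu => ?_
      · ext mu
        simp only [mem_filter, and_assoc]
        refine and_congr_right fun _ => ⟨fun h => ⟨fun j hj => ?_, ?_⟩, fun h j hj => ?_⟩
        · rw [h j (by omega), hcol, if_neg (by omega)]
        · rw [h t le_rfl, hcol, if_pos le_rfl]
        · rw [hcol]
          split_ifs with h3
          · rw [show j = t by omega, h.2]
          · exact h.1 j (by omega)
      · have hs' : mu.colLen t = s := (mem_filter.1 hmu).2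
        rw [prod_range_succ, hs']
        ring
    · intro mu hmu
      rw [mem_filter, mem_subDiagrams] at hmu
      rw [mem_Icc, ← hmu.2 (t + 1) le_rfl]
      exact ⟨mu.colLen_anti t (t + 1) (Nat.le_succ t), colLen_mono hmu.1 t⟩

/-- At `t = lam.rowLen 0` every row is complete, and every `mu ≤ lam` agrees with `⊥` in the columns
from `t` on, so the constraint on `mu` is void. -/
theorem jtDet_succ (L n : ℕ) {lam : YoungDiagram} (hL : lam.colLen 0 ≤ L) :
    jtDet L (n + 1) lam = ∑ mu ∈ subDiagrams lam,
      (∏ j ∈ range (lam.rowLen 0), colWt n lam j (mu.colLen j)) * jtDet L n mu := by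
  have hcol : ∀ mu ≤ lam, ∀ j, lam.rowLen 0 ≤ j → mu.colLen j = 0 := by
    intro mu hmu j hj
    have h1 : ¬ 0 < lam.colLen j := by rw [← lt_rowLen_iff_lt_colLen]; omega
    have := colLen_mono hmu j
    omega
  classical
  have h := mixedDet_eq_sum L n hL (lam.rowLen 0) ⊥ bot_le
  rw [filter_true_of_mem] at h
  · rw [← h]
    refine rowDet_congr fun i _ => ?_
    have := lam.rowLen_anti 0 i (Nat.zero_le i)
    rw [hcol ⊥ bot_le _ le_rfl, if_neg (Nat.not_lt_zero i), truncRow, if_neg (by omega)]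
  · intro mu hmu j hj
    rw [hcol mu (mem_subDiagrams.1 hmu) j hj, hcol ⊥ bot_le j hj]

/-! ### Initial values of the recursion -/

theorem constantCoeff_hSeries (n k b : ℕ) :
    PowerSeries.constantCoeff (hSeries n k b) = 1 := by
  simp [hSeries, geom, map_prod]

theorem rowDet_jtRow_zero (L n : ℕ) : rowDet L (fun i => jtRow L n i 0) = 1 := by
  rw [rowDet, Matrix.det_of_isUpperTriangular]
  · simp [jtRow, PowerSeries.coeff_X_pow_mul', constantCoeff_hSeries]
  · intro i j hij
    have : (j : ℕ) < i := hij
    simp only [Matrix.of_apply, jtRow]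
    rw [PowerSeries.coeff_X_pow_mul', if_neg (by omega)]

theorem jtDet_bot (L n : ℕ) : jtDet L n ⊥ = 1 := by
  rw [← rowDet_jtRow_zero L n]
  refine rowDet_congr fun i _ => ?_
  rw [rowLen_eq_of_mem_iff (k := 0) (by simp)]

theorem rowLen_zero_pos {lam : YoungDiagram} (h : lam ≠ ⊥) : 0 < lam.rowLen 0 := by
  by_contra h0
  refine h (eq_of_colLen_eq fun j => ?_)
  have h1 : ∀ j, ¬ 0 < lam.colLen j := fun j => by rw [← lt_rowLen_iff_lt_colLen]; omega
  rw [colLen_eq_of_mem_iff (mu := ⊥) (k := 0) (by simp)]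
  exact Nat.eq_zero_of_not_pos (h1 j)

/-- The top row holds coefficients of degree at least `λ_1` of a polynomial in `T` of degree at most
`λ_1 - 1`. -/
theorem jtDet_zero (L : ℕ) {lam : YoungDiagram} (hL : lam.colLen 0 ≤ L) (h : lam ≠ ⊥) :
    jtDet L 0 lam = 0 := by
  have h0 := rowLen_zero_pos h
  have h1 := lt_rowLen_iff_lt_colLen.1 h0
  refine rowDet_eq_zero_of_row (a := 0) (by omega) ?_
  funext j
  simp only [jtRow, hSeries, range_zero, prod_empty, one_mul, pow_zero, Pi.zero_apply]
  exact coeff_prod_one_sub_eq_zero _ (fun i => avar (i + 1)) (by rw [card_range]; omega)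

/-- Turns the sum over all markings into a product over cells. -/
theorem sum_powerset_prod_ite {ι R : Type*} [DecidableEq ι] [CommRing R] (s M : Finset ι)
    (hM : M ⊆ s) (u v : ι → R) :
    ∑ m ∈ M.powerset, ∏ c ∈ s, (if c ∈ m then u c else v c) =
      ∏ c ∈ s, (v c + if c ∈ M then u c else 0) := by
  simp_rw [add_comm (v _)]
  rw [prod_add]
  refine sum_subset_zero_on_sdiff (powerset_mono.2 hM) (fun m hm => ?_) fun m hm => ?_
  · rw [mem_sdiff, mem_powerset, mem_powerset] at hm
    obtain ⟨c, hc, hcM⟩ := not_subset.1 hm.2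
    rw [prod_eq_zero hc (if_neg hcM), zero_mul]
  · have hmM := mem_powerset.1 hm
    rw [prod_ite, filter_mem_eq_inter, inter_eq_right.2 (hmM.trans hM), filter_notMem_eq_sdiff]
    congr 1
    exact prod_congr rfl fun c hc => (if_pos (hmM hc)).symm

/-! ### Branching rule for marked reverse plane partitions -/

namespace MRPP

variable {lam mu : YoungDiagram}

theorem maxEntry_le_iff {T : MRPP lam} {n : ℕ} :
    T.maxEntry ≤ n ↔ ∀ i j, T.entry i j ≤ n := by
  rw [maxEntry, Finset.sup_le_iff]
  refine ⟨fun h i j => ?_, fun h c _ => h c.1 c.2⟩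
  by_cases hc : (i, j) ∈ lam
  · exact h (i, j) hc
  · rw [T.entry_zero i j hc]
    exact Nat.zero_le n

/-- The diagram of the cells with entries at most `n`. -/
def inner (n : ℕ) (T : MRPP lam) : YoungDiagram where
  cells := lam.cells.filter fun c => T.entry c.1 c.2 ≤ n
  isLowerSet := by
    rintro ⟨i, j⟩ ⟨i', j'⟩ ⟨hi, hj⟩ hc
    simp only [Finset.coe_filter, Set.mem_ofPred_eq, YoungDiagram.mem_cells] at hc ⊢
    simp only at hi hj
    have h1 := YoungDiagram.up_left_mem lam hi le_rfl hc.1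
    exact ⟨YoungDiagram.up_left_mem lam hi hj hc.1,
      (T.row_weak i' j' j hj h1).trans ((T.col_weak i' i j hi hc.1).trans hc.2)⟩

theorem mem_inner {n : ℕ} {T : MRPP lam} {i j : ℕ} :
    (i, j) ∈ T.inner n ↔ (i, j) ∈ lam ∧ T.entry i j ≤ n := by
  rw [← YoungDiagram.mem_cells]
  simp only [inner, Finset.mem_filter, YoungDiagram.mem_cells]

theorem inner_le (n : ℕ) (T : MRPP lam) : T.inner n ≤ lam :=
  fun _ hc => (Finset.mem_filter.1 hc).1

/-- The restriction of a marked reverse plane partition to the cells with entries at most `n`. -/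
def restrict (n : ℕ) (T : MRPP lam) (h : T.inner n = mu) : MRPP mu where
  entry i j := if (i, j) ∈ mu then T.entry i j else 0
  marked := T.marked.filter fun c => c ∈ mu
  entry_pos i j hij := by
    rw [if_pos hij]
    rw [← h, mem_inner] at hij
    exact T.entry_pos i j hij.1
  entry_zero i j hij := if_neg hij
  row_weak i j₁ j₂ hj hij := by
    rw [if_pos hij, if_pos (YoungDiagram.up_left_mem mu le_rfl hj hij)]
    rw [← h, mem_inner] at hij
    exact T.row_weak i j₁ j₂ hj hij.1
  col_weak i₁ i₂ j hi hij := by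
    rw [if_pos hij, if_pos (YoungDiagram.up_left_mem mu hi le_rfl hij)]
    rw [← h, mem_inner] at hij
    exact T.col_weak i₁ i₂ j hi hij.1
  marked_eq i j hij := by
    rw [mem_filter] at hij
    obtain ⟨_, h2, h3⟩ := T.marked_eq i j hij.1
    have h4 : (i, j + 1) ∈ mu := by
      rw [← h, mem_inner] at hij ⊢
      exact ⟨h2, h3 ▸ hij.2.2⟩
    rw [if_pos hij.2, if_pos h4]
    exact ⟨hij.2, h4, h3⟩

/-- The cells of `lam` outside of `mu` that have a right neighbour in `lam`. -/
def markable (lam mu : YoungDiagram) : Finset (ℕ × ℕ) :=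
  (lam.cells \ mu.cells).filter fun c => (c.1, c.2 + 1) ∈ lam

theorem mem_markable {i j : ℕ} :
    (i, j) ∈ markable lam mu ↔ ((i, j) ∈ lam ∧ (i, j) ∉ mu) ∧ (i, j + 1) ∈ lam := by
  simp [markable]

/-- Extending a marked reverse plane partition of shape `mu` by entries `n + 1`. -/
def extend (n : ℕ) (hmu : mu ≤ lam) (T : MRPP mu) (hT : T.maxEntry ≤ n) (m : Finset (ℕ × ℕ))
    (hm : m ⊆ markable lam mu) : MRPP lam where
  entry i j := if (i, j) ∈ mu then T.entry i j else if (i, j) ∈ lam then n + 1 else 0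
  marked := T.marked ∪ m
  entry_pos i j hij := by
    split_ifs with h
    · exact T.entry_pos i j h
    · omega
  entry_zero i j hij := by
    rw [if_neg fun h => hij (hmu h), if_neg hij]
  row_weak i j₁ j₂ hj hij := by
    have h1 := YoungDiagram.up_left_mem lam le_rfl hj hij
    have h2 := maxEntry_le_iff.1 hT i j₁
    rw [if_pos hij, if_pos h1]
    by_cases h : (i, j₂) ∈ mu
    · rw [if_pos h, if_pos (YoungDiagram.up_left_mem mu le_rfl hj h)]
      exact T.row_weak i j₁ j₂ hj h
    · rw [if_neg h]
      split_ifs <;> omega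
  col_weak i₁ i₂ j hi hij := by
    have h1 := YoungDiagram.up_left_mem lam hi le_rfl hij
    have h2 := maxEntry_le_iff.1 hT i₁ j
    rw [if_pos hij, if_pos h1]
    by_cases h : (i₂, j) ∈ mu
    · rw [if_pos h, if_pos (YoungDiagram.up_left_mem mu hi le_rfl h)]
      exact T.col_weak i₁ i₂ j hi h
    · rw [if_neg h]
      split_ifs <;> omega
  marked_eq i j hij := by
    rcases mem_union.1 hij with h | h
    · obtain ⟨h1, h2, h3⟩ := T.marked_eq i j h
      rw [if_pos h1, if_pos h2]
      exact ⟨hmu h1, hmu h2, h3⟩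
    · obtain ⟨⟨h1, h2⟩, h3⟩ := mem_markable.1 (hm h)
      have h4 : (i, j + 1) ∉ mu := fun h =>
        h2 (YoungDiagram.up_left_mem mu le_rfl (Nat.le_succ j) h)
      rw [if_neg h2, if_pos h1, if_neg h4, if_pos h3]
      exact ⟨h1, h3, rfl⟩

variable {n : ℕ}

section extend

variable (hmu : mu ≤ lam) (T : MRPP mu) (hT : T.maxEntry ≤ n) (m : Finset (ℕ × ℕ))
  (hm : m ⊆ markable lam mu)

theorem maxEntry_extend_le : (extend n hmu T hT m hm).maxEntry ≤ n + 1 := by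
  rw [maxEntry_le_iff]
  intro i j
  have := maxEntry_le_iff.1 hT i j
  simp only [extend]
  split_ifs <;> omega

theorem inner_extend : (extend n hmu T hT m hm).inner n = mu := by
  ext ⟨i, j⟩
  rw [YoungDiagram.mem_cells, YoungDiagram.mem_cells, mem_inner]
  have := maxEntry_le_iff.1 hT i j
  have h1 : (i, j) ∈ mu → (i, j) ∈ lam := fun h => hmu h
  simp only [extend]
  split_ifs with h2 h3
  · exact ⟨fun _ => h2, fun _ => ⟨h1 h2, this⟩⟩
  · exact ⟨fun h => by omega, fun h => absurd h h2⟩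
  · exact ⟨fun h => absurd h.1 h3, fun h => absurd h h2⟩

theorem mem_of_mem_marked {T : MRPP mu} {c : ℕ × ℕ} (h : c ∈ T.marked) : c ∈ mu :=
  (T.marked_eq c.1 c.2 h).1

theorem restrict_extend (h : (extend n hmu T hT m hm).inner n = mu) :
    restrict n (extend n hmu T hT m hm) h = T := by
  refine MRPP.ext ?_ ?_
  · funext i j
    simp only [restrict, extend]
    split_ifs with h1
    · rfl
    · exact (T.entry_zero i j h1).symm
  · ext ⟨i, j⟩
    simp only [restrict, extend, mem_filter, mem_union]
    refine ⟨fun h => h.1.resolve_right fun h' => ?_, fun h => ⟨Or.inl h, mem_of_mem_marked h⟩⟩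
    exact (mem_markable.1 (hm h')).1.2 h.2

theorem marked_extend_filter :
    (extend n hmu T hT m hm).marked.filter (fun c => c ∉ mu) = m := by
  ext ⟨i, j⟩
  simp only [extend, mem_filter, mem_union]
  refine ⟨fun h => h.1.resolve_left fun h' => h.2 (mem_of_mem_marked h'),
    fun h => ⟨Or.inr h, (mem_markable.1 (hm h)).1.2⟩⟩

theorem wt_extend : (extend n hmu T hT m hm).wt = T.wt * ∏ c ∈ lam.cells \ mu.cells,
    (if c ∈ m then -avar (c.2 + 1) else
      if c.1 = mu.colLen c.2 then xvar (n + 1) else bvar c.1) := by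
  rw [wt, ← prod_sdiff (YoungDiagram.cells_subset_iff.2 hmu), mul_comm, wt]
  congr 1
  · refine prod_congr rfl fun c hc => ?_
    obtain ⟨i, j⟩ := c
    have h1 : (i, j) ∈ mu := hc
    have h2 : (i, j) ∈ (extend n hmu T hT m hm).marked ↔ (i, j) ∈ T.marked := by
      simp only [extend, mem_union, or_iff_left_iff_imp]
      exact fun h => absurd h1 (mem_markable.1 (hm h)).1.2
    have h3 : ∀ i' ≤ i, (extend n hmu T hT m hm).entry i' j = T.entry i' j := fun i' hi =>
      if_pos (YoungDiagram.up_left_mem mu hi le_rfl h1)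
    simp only [cellWt, h2, h3 i le_rfl, h3 (i - 1) (Nat.sub_le i 1)]
  · refine prod_congr rfl fun c hc => ?_
    obtain ⟨i, j⟩ := c
    rw [mem_sdiff, YoungDiagram.mem_cells, YoungDiagram.mem_cells] at hc
    have h2 : (i, j) ∈ (extend n hmu T hT m hm).marked ↔ (i, j) ∈ m := by
      simp only [extend, mem_union, or_iff_right_iff_imp]
      exact fun h => absurd (mem_of_mem_marked h) hc.2
    have h3 : (extend n hmu T hT m hm).entry i j = n + 1 := by
      simp only [extend, if_neg hc.2, if_pos hc.1]
    have h4 : mu.colLen j ≤ i := by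
      have := hc.2
      rw [YoungDiagram.mem_iff_lt_colLen] at this
      omega
    -- Among the cells with entry `n + 1`, only the top one of its column lacks an equal entry above
    -- it.
    have h5 : (0 < i ∧ n + 1 = (extend n hmu T hT m hm).entry (i - 1) j) ↔
        ¬ i = mu.colLen j := by
      have h6 := YoungDiagram.up_left_mem lam (Nat.sub_le i 1) le_rfl hc.1
      have h7 := maxEntry_le_iff.1 hT (i - 1) j
      simp only [extend, if_pos h6]
      by_cases h8 : (i - 1, j) ∈ mu
      · rw [if_pos h8]
        rw [YoungDiagram.mem_iff_lt_colLen] at h8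
        omega
      · rw [if_neg h8]
        rw [YoungDiagram.mem_iff_lt_colLen] at h8
        omega
    simp only [cellWt, h2, h3, h5]
    split_ifs <;> rfl

end extend

theorem marked_filter_subset (T : MRPP lam) :
    T.marked.filter (fun c => c ∉ mu) ⊆ markable lam mu := by
  rintro ⟨i, j⟩ hc
  rw [mem_filter] at hc
  obtain ⟨h1, h2, _⟩ := T.marked_eq i j hc.1
  exact mem_markable.2 ⟨⟨h1, hc.2⟩, h2⟩

theorem maxEntry_restrict_le (T : MRPP lam) (h : T.inner n = mu) :
    (restrict n T h).maxEntry ≤ n := by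
  rw [maxEntry_le_iff]
  intro i j
  simp only [restrict]
  split_ifs with h1
  · rw [← h, mem_inner] at h1
    exact h1.2
  · exact Nat.zero_le n

theorem extend_restrict (hmu : mu ≤ lam) (T : MRPP lam) (hT : T.maxEntry ≤ n + 1)
    (h : T.inner n = mu) :
    extend n hmu (restrict n T h) (maxEntry_restrict_le T h) (T.marked.filter fun c => c ∉ mu)
      (marked_filter_subset T) = T := by
  refine MRPP.ext ?_ ?_
  · funext i j
    simp only [extend, restrict]
    split_ifs with h1 h2
    · rfl
    · have h3 := maxEntry_le_iff.1 hT i j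
      rw [← h, mem_inner] at h1
      have h4 : ¬ T.entry i j ≤ n := fun h' => h1 ⟨h2, h'⟩
      omega
    · exact (T.entry_zero i j h2).symm
  · simp only [extend, restrict]
    exact filter_union_filter_not_eq _ _

/-- `restrict` and `extend` identify the fiber with pairs consisting of a filling of `mu` and a set
of marked cells of `lam / mu`. -/
theorem sum_wt_fiber (hmu : mu ≤ lam) [DecidableEq YoungDiagram] :
    ∑ T : {T : MRPP lam // T.maxEntry ≤ n + 1} with T.1.inner n = mu, T.1.wt =
      (∏ j ∈ range (lam.rowLen 0), colWt n lam j (mu.colLen j)) *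
        ∑ T : {T : MRPP mu // T.maxEntry ≤ n}, T.1.wt := by
  have h1 : ∏ j ∈ range (lam.rowLen 0), colWt n lam j (mu.colLen j) =
      ∏ c ∈ lam.cells \ mu.cells, ((if c.1 = mu.colLen c.2 then xvar (n + 1) else bvar c.1) +
        if c ∈ markable lam mu then -avar (c.2 + 1) else 0) := by
    simp only [colWt]
    rw [prod_sigma']
    refine prod_bij' (fun c _ => (c.2, c.1)) (fun c _ => ⟨c.2, c.1⟩) ?_ ?_ ?_ ?_ ?_
    · rintro ⟨j, i⟩ hc
      have hc' := mem_Ico.1 (mem_sigma.1 hc).2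
      rw [mem_sdiff, YoungDiagram.mem_cells, YoungDiagram.mem_cells,
        YoungDiagram.mem_iff_lt_colLen, YoungDiagram.mem_iff_lt_colLen]
      exact ⟨hc'.2, hc'.1.not_gt⟩
    · rintro ⟨i, j⟩ hc
      rw [mem_sdiff, YoungDiagram.mem_cells, YoungDiagram.mem_cells,
        YoungDiagram.mem_iff_lt_colLen, YoungDiagram.mem_iff_lt_colLen] at hc
      refine mem_sigma.2 ⟨mem_range.2 (lt_rowLen_iff_lt_colLen.2 ?_), mem_Ico.2 ?_⟩
      · exact (Nat.zero_le i).trans_lt hc.1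
      · exact ⟨not_lt.1 hc.2, hc.1⟩
    · intro c _
      rfl
    · intro c _
      rfl
    · rintro ⟨j, i⟩ hc
      simp only [mem_sigma, mem_range, mem_Ico] at hc
      have h2 : (i, j) ∈ markable lam mu ↔ j + 1 < lam.rowLen i := by
        rw [mem_markable, YoungDiagram.mem_iff_lt_colLen, YoungDiagram.mem_iff_lt_colLen,
          YoungDiagram.mem_iff_lt_rowLen]
        exact ⟨fun h => h.2, fun h => ⟨by omega, h⟩⟩
      simp only [h2]
      split_ifs <;> ring
  rw [h1, ← sum_powerset_prod_ite _ (markable lam mu) (filter_subset _ _) (fun c => -avar (c.2 + 1))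
    (fun c => if c.1 = mu.colLen c.2 then xvar (n + 1) else bvar c.1), mul_comm, sum_mul_sum, ← sum_product']
  refine sum_bij' (fun T hT => (⟨restrict n T.1 (mem_filter.1 hT).2, maxEntry_restrict_le _ _⟩,
      T.1.marked.filter fun c => c ∉ mu))
    (fun p hp => ⟨extend n hmu p.1.1 p.1.2 p.2 (mem_powerset.1 (mem_product.1 hp).2),
      maxEntry_extend_le hmu _ _ _ _⟩) ?_ ?_ ?_ ?_ ?_
  · intro T hT
    exact mem_product.2 ⟨mem_univ _,
      mem_powerset.2 (marked_filter_subset T.1)⟩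
  · intro p hp
    exact mem_filter.2 ⟨mem_univ _, inner_extend hmu _ p.1.2 _
      (mem_powerset.1 (mem_product.1 hp).2)⟩
  · intro T hT
    exact Subtype.ext (extend_restrict hmu T.1 T.2 (mem_filter.1 hT).2)
  · intro p hp
    have hm := mem_powerset.1 (mem_product.1 hp).2
    exact Prod.ext (Subtype.ext (restrict_extend hmu _ p.1.2 _ hm (inner_extend ..)))
      (marked_extend_filter hmu _ p.1.2 _ hm)
  · intro T hT
    rw [← wt_extend hmu _ (maxEntry_restrict_le T.1 (mem_filter.1 hT).2) _
      (marked_filter_subset T.1),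
      extend_restrict hmu T.1 T.2 (mem_filter.1 hT).2]

theorem sum_wt_succ (n : ℕ) (lam : YoungDiagram) :
    ∑ T : {T : MRPP lam // T.maxEntry ≤ n + 1}, T.1.wt = ∑ mu ∈ subDiagrams lam,
      (∏ j ∈ range (lam.rowLen 0), colWt n lam j (mu.colLen j)) *
        ∑ T : {T : MRPP mu // T.maxEntry ≤ n}, T.1.wt := by
  classical
  rw [← sum_fiberwise_of_maps_to (t := subDiagrams lam)
    (g := fun T : {T : MRPP lam // T.maxEntry ≤ n + 1} => T.1.inner n)
    fun T _ => mem_subDiagrams.2 (inner_le n T.1)]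
  exact sum_congr rfl fun mu hmu => sum_wt_fiber (mem_subDiagrams.1 hmu)

theorem sum_wt_bot (n : ℕ) : ∑ T : {T : MRPP ⊥ // T.maxEntry ≤ n}, T.1.wt = 1 := by
  have hm : ∀ T : MRPP ⊥, T.marked = ∅ := fun T =>
    eq_empty_of_forall_notMem fun c hc => YoungDiagram.notMem_bot c (mem_of_mem_marked hc)
  have he : ∀ (T : MRPP ⊥) i j, T.entry i j = 0 := fun T i j =>
    T.entry_zero i j (YoungDiagram.notMem_bot _)
  let T₀ : MRPP ⊥ := ⟨fun _ _ => 0, ∅, fun i j h => absurd h (YoungDiagram.notMem_bot _),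
    fun _ _ _ => rfl, fun _ _ _ _ _ => le_rfl, fun _ _ _ _ _ => le_rfl,
    fun _ _ h => absurd h (notMem_empty _)⟩
  rw [Fintype.sum_eq_single (⟨T₀, maxEntry_le_iff.2 fun _ _ => Nat.zero_le n⟩ :
    {T : MRPP ⊥ // T.maxEntry ≤ n})]
  · simp [wt]
  · intro T hT
    refine absurd (Subtype.ext (MRPP.ext ?_ ?_)) hT
    · funext i j
      exact he T.1 i j
    · exact hm T.1

theorem sum_wt_zero {lam : YoungDiagram} (h : lam ≠ ⊥) :
    ∑ T : {T : MRPP lam // T.maxEntry ≤ 0}, T.1.wt = 0 := by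
  refine sum_eq_zero fun T _ => ?_
  have h1 := maxEntry_le_iff.1 T.2 0 0
  have h2 := T.1.entry_pos 0 0 (YoungDiagram.mem_iff_lt_rowLen.2 (rowLen_zero_pos h))
  omega

end MRPP

/-- The Jacobi–Trudi formula for the generating polynomial of marked reverse plane partitions. -/
theorem sum_wt_eq_jtDet (L n : ℕ) (lam : YoungDiagram) (hL : lam.colLen 0 ≤ L) :
    ∑ T : {T : MRPP lam // T.maxEntry ≤ n}, T.1.wt = jtDet L n lam := by
  induction n generalizing lam with
  | zero =>
    by_cases h : lam = ⊥
    · subst h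
      rw [MRPP.sum_wt_bot, jtDet_bot]
    · rw [MRPP.sum_wt_zero h, jtDet_zero L hL h]
  | succ n ih =>
    rw [MRPP.sum_wt_succ, jtDet_succ L n hL]
    refine sum_congr rfl fun mu hmu => ?_
    rw [ih mu ((colLen_mono (mem_subDiagrams.1 hmu) 0).trans hL)]

/-! ### From the bialternant to the Jacobi–Trudi determinant -/

theorem coeff_prod_geom (Y : Finset Var) (m : ℕ) :
    coeff m (∏ v ∈ Y, geom (MvPolynomial.X v : PolyRing)) = hPos m Y := by
  have hs : ∀ (s : Multiset Y) (f : Y → PolyRing), (s.map f).prod = ∏ v, f v ^ s.count v := by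
    intro s f
    rw [Finset.prod_multiset_map_count]
    refine prod_subset (subset_univ _) fun v _ hv => ?_
    rw [Multiset.mem_toFinset, ← Multiset.count_eq_zero] at hv
    rw [hv, pow_zero]
  -- Exponent vectors of total degree `m` on the left correspond to the multisets of size `m` that
  -- index `hsymm`.
  rw [coeff_prod, hPos, MvPolynomial.hsymm, map_sum,
    ← (finsuppAntidiagEquiv Y m).sum_comp, ← sum_coe_sort]
  refine sum_congr rfl fun l _ => ?_
  rw [map_multiset_prod, Multiset.map_map, hs, ← prod_coe_sort]
  refine prod_congr rfl fun v _ => ?_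
  have h := count_coe_finsuppAntidiagEquiv_apply (s := Y) m l v
  simp only [geom, coeff_mk, Function.comp_apply, MvPolynomial.rename_X]
  rw [← h]
  rfl

theorem coeff_prod_one_sub (Z : Finset Var) (m : ℕ) :
    coeff m (∏ v ∈ Z, (1 - C (MvPolynomial.X v : PolyRing) * X)) = (-1) ^ m * ePos m Z := by
  have h : ∀ t : Finset Z, ∏ v ∈ t, -(C (MvPolynomial.X (v : Var) : PolyRing) * X) =
      C ((-1) ^ #t * ∏ v ∈ t, MvPolynomial.X (v : Var)) * X ^ #t := by
    intro t
    rw [prod_neg, prod_mul_distrib, prod_const, map_mul, map_pow, map_neg, map_one, map_prod]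
    ring
  rw [ePos, MvPolynomial.esymm, ← prod_coe_sort]
  simp_rw [sub_eq_add_neg]
  rw [prod_one_add, map_sum, map_sum, mul_sum, powersetCard_eq_filter, sum_filter]
  refine sum_congr rfl fun t _ => ?_
  rw [h, coeff_C_mul, coeff_X_pow]
  split_ifs with h1 h2 h2
  · simp [h1, map_prod]
  · exact absurd h1.symm h2
  · exact absurd h2.symm h1
  · simp

theorem hPleth_eq_coeff (m : ℕ) (Y Z : Finset Var) :
    hPleth m Y Z = coeff m ((∏ v ∈ Y, geom (MvPolynomial.X v : PolyRing)) *
      ∏ v ∈ Z, (1 - C (MvPolynomial.X v : PolyRing) * X)) := by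
  rw [coeff_mul, hPleth]
  simp_rw [coeff_prod_geom, coeff_prod_one_sub]

theorem prod_alphas {M : Type*} [CommMonoid M] (k : ℕ) (f : Var → M) :
    ∏ v ∈ alphas k, f v = ∏ i ∈ range k, f (Var.α (i + 1)) := by
  rw [alphas, prod_image (fun a _ b _ h => Var.α.inj h), range_eq_Ico,
    prod_Ico_add' (fun i => f (Var.α i))]
  rfl

theorem prod_betas {M : Type*} [CommMonoid M] (k : ℕ) (f : Var → M) :
    ∏ v ∈ betas k, f v = ∏ i ∈ range k, f (Var.β (i + 1)) := by
  rw [betas, prod_image (fun a _ b _ h => Var.β.inj h), range_eq_Ico,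
    prod_Ico_add' (fun i => f (Var.β i))]
  rfl

/-- The coefficients of `∏_{l ≠ j} (1 - x_l T)`, in decreasing order of degree. -/
noncomputable def complCoeff (n : ℕ) : Matrix (Fin n) (Fin n) PolyRing :=
  Matrix.of fun k j => coeff (n - 1 - k)
    (∏ l ∈ (range n).erase j, (1 - C (xvar (l + 1)) * X))

theorem prod_geom_mul_prod_erase {n j : ℕ} (hj : j < n) :
    (∏ l ∈ range n, geom (xvar (l + 1))) * ∏ l ∈ (range n).erase j, (1 - C (xvar (l + 1)) * X) =
      geom (xvar (j + 1)) := by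
  rw [← mul_prod_erase _ _ (mem_range.2 hj), mul_assoc, ← prod_mul_distrib,
    prod_eq_one, mul_one]
  intro l _
  rw [mul_comm, one_sub_mul_geom]

/-- Factorization of the matrices `(h_{m_i + n - 1 - i}[x_j + Z_i])`. -/
theorem det_coeff_geom_mul (n : ℕ) (m : ℕ → ℕ) (Q : ℕ → PolyRing⟦X⟧) :
    (Matrix.of fun i j : Fin n =>
      coeff (m i + (n - 1 - i)) (geom (xvar ((j : ℕ) + 1)) * Q i)).det =
    rowDet n (fun i j => coeff (m i + j)
      (X ^ i * ((∏ l ∈ range n, geom (xvar (l + 1))) * Q i))) * (complCoeff n).det := by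
  rw [rowDet, ← Matrix.det_mul]
  congr 1
  ext i j : 1
  rw [Matrix.mul_apply]
  simp only [Matrix.of_apply, complCoeff]
  set E : PolyRing⟦X⟧ := ∏ l ∈ (range n).erase j, (1 - C (xvar (l + 1)) * X) with hE
  set S : PolyRing⟦X⟧ := X ^ (i : ℕ) * ((∏ l ∈ range n, geom (xvar (l + 1))) * Q i) with hS
  have h1 : coeff (m i + (n - 1 - i)) (geom (xvar ((j : ℕ) + 1)) * Q i) =
      coeff (m i + (n - 1)) (S * E) := by
    have h2 : S * E = X ^ (i : ℕ) * (geom (xvar ((j : ℕ) + 1)) * Q i) := by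
      rw [hS, ← prod_geom_mul_prod_erase j.2, hE]
      ring
    have : m i + (n - 1) = m i + (n - 1 - i) + i := by omega
    rw [h2, this, coeff_X_pow_mul]
  have hzero : ∀ d, n - 1 < d → coeff d E = 0 := by
    intro d hd
    refine coeff_prod_one_sub_eq_zero _ _ ?_
    rwa [card_erase_of_mem (mem_range.2 j.2), card_range]
  -- `E` has degree at most `n - 1`, so only the last `n` terms of the convolution survive, and
  -- these form a row of the matrix product.
  have h3 : ∑ k ∈ range n, coeff (m i + k) S * coeff (n - 1 - k) E =
      ∑ k ∈ range (m i + n), coeff k S * coeff (m i + (n - 1) - k) E := by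
    have h4 : ∑ k ∈ range (m i), coeff k S * coeff (m i + (n - 1) - k) E = 0 :=
      sum_eq_zero fun k hk => by
        rw [mem_range] at hk
        rw [hzero _ (by omega), mul_zero]
    rw [sum_range_add (fun k => coeff k S * coeff (m i + (n - 1) - k) E), h4, zero_add]
    refine sum_congr rfl fun k _ => ?_
    rw [Nat.add_sub_add_left]
  have hn : 0 < n := by have := i.2; omega
  have hsucc : (m i + (n - 1)).succ = m i + n := by omega
  rw [h1, coeff_mul, Nat.sum_antidiagonal_eq_sum_range_succ
    (f := fun a b => coeff a S * coeff b E), Fin.sum_univ_eq_sum_range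
    (fun k => coeff (m i + k) S * coeff (n - 1 - k) E), h3, hsucc]

/-- The factorization with `m = 0`, `Q = 1`: the row determinant is unitriangular, and the left side
is the determinant of `x_j^{n-1-i}`. -/
theorem det_complCoeff (n : ℕ) : (complCoeff n).det = vdm n := by
  have h := det_coeff_geom_mul n 0 1
  have h1 : rowDet n (fun i j => coeff ((0 : ℕ → ℕ) i + j)
      (X ^ i * ((∏ l ∈ range n, geom (xvar (l + 1))) * (1 : ℕ → PolyRing⟦X⟧) i))) = 1 := by
    rw [rowDet, Matrix.det_of_isUpperTriangular]
    · simp [coeff_X_pow_mul', geom, map_prod]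
    · intro i j hij
      have : (j : ℕ) < i := hij
      simp only [Matrix.of_apply, Pi.zero_apply, zero_add]
      rw [coeff_X_pow_mul', if_neg (by omega)]
  rw [h1, one_mul] at h
  rw [← h, ← Matrix.det_transpose]
  -- The projective form with first coordinates `1` has decreasing powers of `x`, which gives the
  -- factors `x_i - x_j` without a sign correction.
  have h2 := Matrix.det_projVandermonde (R := PolyRing) (n := n) 1 (fun i => xvar ((i : ℕ) + 1))
  simp only [Pi.one_apply, one_mul] at h2
  rw [vdm, ← h2]
  congr 1
  ext i j : 1
  simp only [Matrix.transpose_apply, Matrix.of_apply, Matrix.projVandermonde_apply, Pi.one_apply,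
    Pi.zero_apply, zero_add, mul_one, one_pow, one_mul, geom, coeff_mk, Fin.val_rev]
  rw [show n - 1 - (j : ℕ) = n - (j + 1) by omega]

theorem vdm_ne_zero (n : ℕ) : vdm n ≠ 0 := by
  rw [vdm, prod_ne_zero_iff]
  intro i _
  rw [prod_ne_zero_iff]
  intro j hj
  rw [mem_Ioi] at hj
  rw [sub_ne_zero]
  intro h
  have := Var.x.inj (MvPolynomial.X_injective h)
  omega

/-- The bialternant is the Jacobi–Trudi determinant times the Vandermonde determinant. -/
theorem det_gMatrix (n : ℕ) (lam : YoungDiagram) :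
    (gMatrix n lam).det = jtDet n n lam * vdm n := by
  rw [← det_complCoeff]
  refine Eq.trans ?_ ((det_coeff_geom_mul n lam.rowLen fun i =>
    (∏ l ∈ range i, geom (bvar (l + 1))) *
      ∏ l ∈ range (lam.rowLen i - 1), (1 - C (avar (l + 1)) * X)).trans ?_)
  · congr 1
    ext i j : 1
    have hx : Var.x ((j : ℕ) + 1) ∉ betas i := by simp [betas]
    rw [gMatrix, Matrix.of_apply, Matrix.of_apply, hPleth_eq_coeff, prod_insert hx, prod_betas,
      prod_alphas, mul_assoc]
    rfl
  · congr 1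
    refine rowDet_congr fun i _ => ?_
    funext j
    rw [jtRow, hSeries, mul_assoc (∏ l ∈ range n, geom (xvar (l + 1)))]

end DualGrothendieck

theorem corollary4p3 (n : ℕ) (lam : YoungDiagram) (hlam : lam.colLen 0 ≤ n) :
    DualGrothendieck.g n lam =
      algebraMap DualGrothendieck.PolyRing DualGrothendieck.RatField
        (∑ T : {T : DualGrothendieck.MRPP lam // T.maxEntry ≤ n}, T.1.wt) := by
  rw [DualGrothendieck.sum_wt_eq_jtDet n n lam hlam, DualGrothendieck.g,
    DualGrothendieck.det_gMatrix, map_mul]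
  refine mul_div_cancel_right₀ _ fun h => DualGrothendieck.vdm_ne_zero n ?_
  exact (IsFractionRing.injective DualGrothendieck.PolyRing DualGrothendieck.RatField)
    (h.trans (map_zero _).symm)
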